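/- Let $(\mathsf E,\mathscr E)$ be a measurable space whose diagonal $\{(x,x):x\in\mathsf E\}$ is measurable in $\mathsf E\times\mathsf E$, let $\mu$ be a probability measure on it, and let $T$ be a $\mu$-invariant Markov kernel on $\mathsf E$. Let $T$ also denote the bounded operator $(Tf)(x)=\int f(y)\,T(x,\mathrm dy)$ on the real Hilbert space $L^2(\mu)$, with adjoint $T^*$, and put $L^2_0(\mu)=\{f\in L^2(\mu):\mu(f)=0\}$. Definitions. - $T$ is $\mu$-irreducible if for every $A\in\mathscr E$ with $\mu(A)>0$ and every $x\in\mathsf E$ there is $n\ge 0$ with $T^n(x,A)>0$ (equivalently, $\sum_{n\ge0}\lambda^nT^n(x,A)>0$ for some, and hence all, $\lambda\in(0,1)$). - For a bounded operator $S$ on $L^2(\mu)$, $\mathcal E(S,f)=\langle(\mathrm{Id}-S)f,f\rangle$. - $\|f\|_{\mathrm{osc}}=\operatorname{ess\,sup}_\mu f-\operatorname{ess\,inf}_\mu f\in[0,\infty]$, and $\Phi=\|\cdot\|_{\mathrm{osc}}^2$. This is a sieve: $\Phi(cf)=c^2\Phi(f)$ for $f\in L^2(\mu)$ and $c>0$,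 and there is a finite constant $a$ with $\|f\|_2^2\le a\,\Phi(f)$ for all $f\in L^2_0(\mu)$. - $S$ possesses a $\Phi$-weak Poincaré inequality ($\Phi$-WPI) if there is a decreasing function $\alpha:(0,\infty)\to[0,\infty)$ with $$\|f\|_2^2\le\alpha(r)\,\mathcal E(S,f)+r\,\Phi(f)\qquad\text{for all } r>0,\ f\in L^2_0(\mu),$$ or a decreasing function $\beta:(0,\infty)\to[0,\infty)$ with $\beta(s)\to0$ as $s\to\infty$ and $$\|f\|_2^2\le s\,\mathcal E(S,f)+\beta(s)\,\Phi(f)\qquad\text{for all } s>0,\ f\in L^2_0(\mu).$$ - $T$ is $\Phi$-convergent if there is a decreasing sequence $\gamma(n)\to0$ with $\|T^nf\|_2^2\le\gamma(n)\,\Phi(f)$ for all $n\ge1$ and all $f\in L^2_0(\mu)$ with $0<\Phi(f)<\infty$. Here decreasing means non-increasing. Claim. Suppose that $T$ is $\mu$-irreducible. Then $T$ possesses a $\|\cdot\|_{\mathrm{osc}}^2$-WPI. If moreover $\operatorname{ess\,inf}_{\mu,\,x}T(x,\{x\})>0$, then $T^*T$ possesses a $\|\cdot\|_{\mathrm{osc}}^2$-WPI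 and $T$ is $\|\cdot\|_{\mathrm{osc}}^2$-convergent. -/

import Mathlib

open MeasureTheory ProbabilityTheory Filter Topology
open scoped ENNReal NNReal

namespace MarkovWPI

noncomputable section

section Operator

variable {E : Type*} [MeasurableSpace E] {μ : Measure E} {T : Kernel E E}

/-- Functions that agree `μ`-almost everywhere agree `T x`-almost everywhere for `μ`-almost
every `x`, when `μ` is invariant under `T`. -/
theorem ae_ae_of_invariant (hT : T.Invariant μ) {p : E → Prop} (h : ∀ᵐ y ∂μ, p y) :
    ∀ᵐ x ∂μ, ∀ᵐ y ∂(T x), p y := by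
  rw [← hT.def] at h
  exact Measure.ae_ae_of_ae_comp h

theorem lintegral_lintegral_of_invariant (hT : T.Invariant μ) {g : E → ℝ≥0∞}
    (hg : Measurable g) : ∫⁻ x, ∫⁻ y, g y ∂(T x) ∂μ = ∫⁻ y, g y ∂μ := by
  conv_rhs => rw [← hT.def]
  rw [Measure.lintegral_bind T.aemeasurable hg.aemeasurable]

theorem lintegral_sq_of_invariant (hT : T.Invariant μ) (f : Lp ℝ 2 μ) :
    ∫⁻ x, ∫⁻ y, ‖f y‖ₑ ^ 2 ∂(T x) ∂μ = ‖f‖ₑ ^ 2 := by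
  rw [lintegral_lintegral_of_invariant hT
    ((Lp.stronglyMeasurable f).measurable.enorm.pow_const 2), Lp.enorm_def]
  have h := eLpNorm_nnreal_pow_eq_lintegral (μ := μ) (f := fun y => f y) (p := 2) (by norm_num)
  simpa using h.symm

/-- For `f` in `L²(μ)`, the function `f` is square-integrable under `T x` for almost all `x`. -/
theorem ae_memLp (hT : T.Invariant μ) (f : Lp ℝ 2 μ) :
    ∀ᵐ x ∂μ, MemLp (fun y => f y) 2 (T x) := by
  have hm : Measurable fun x => ∫⁻ y, ‖f y‖ₑ ^ 2 ∂(T x) :=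
    ((Lp.stronglyMeasurable f).measurable.enorm.pow_const 2).lintegral_kernel
  have hfin : ∫⁻ x, ∫⁻ y, ‖f y‖ₑ ^ 2 ∂(T x) ∂μ ≠ ∞ := by
    rw [lintegral_sq_of_invariant hT f]
    exact ENNReal.pow_ne_top enorm_ne_top
  filter_upwards [ae_lt_top hm hfin] with x hx
  refine ⟨(Lp.stronglyMeasurable f).aestronglyMeasurable, ?_⟩
  have h := eLpNorm_nnreal_pow_eq_lintegral (μ := T x) (f := fun y => f y) (p := 2) (by norm_num)
  by_contra hcon
  rw [not_lt_top_iff] at hcon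
  simp only [ENNReal.coe_ofNat, NNReal.coe_ofNat, ENNReal.rpow_ofNat] at h
  rw [hcon] at h
  simp only [← h] at hx
  simp at hx

theorem ae_integrable [IsMarkovKernel T] (hT : T.Invariant μ) (f : Lp ℝ 2 μ) :
    ∀ᵐ x ∂μ, Integrable (fun y => f y) (T x) := by
  filter_upwards [ae_memLp hT f] with x hx
  exact hx.integrable (by norm_num)

/-- The action of `T` on functions: `x ↦ ∫ f(y) T(x, dy)`. -/
def act (T : Kernel E E) (f : E → ℝ) (x : E) : ℝ := ∫ y, f y ∂(T x)

theorem stronglyMeasurable_act (f : Lp ℝ 2 μ) : StronglyMeasurable (act T f) :=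
  StronglyMeasurable.integral_kernel (Lp.stronglyMeasurable f)

variable [IsMarkovKernel T]

theorem eLpNorm_act_le (hT : T.Invariant μ) (f : Lp ℝ 2 μ) :
    eLpNorm (act T f) 2 μ ≤ ‖f‖ₑ := by
  have h1 : eLpNorm (act T f) 2 μ ^ 2 = ∫⁻ x, ‖act T f x‖ₑ ^ 2 ∂μ := by
    have h := eLpNorm_nnreal_pow_eq_lintegral (μ := μ) (f := act T f) (p := 2) (by norm_num)
    simpa using h
  have h2 : ∀ x, ‖act T f x‖ₑ ^ 2 ≤ ∫⁻ y, ‖f y‖ₑ ^ 2 ∂(T x) := by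
    intro x
    have h3 : ‖act T f x‖ₑ ≤ eLpNorm (fun y => f y) 2 (T x) := by
      refine (enorm_integral_le_lintegral_enorm _).trans ?_
      rw [← eLpNorm_one_eq_lintegral_enorm]
      exact eLpNorm_le_eLpNorm_of_exponent_le (by norm_num)
        (Lp.stronglyMeasurable f).aestronglyMeasurable
    have h4 := eLpNorm_nnreal_pow_eq_lintegral (μ := T x) (f := fun y => f y) (p := 2)
      (by norm_num)
    simp only [ENNReal.coe_ofNat, NNReal.coe_ofNat, ENNReal.rpow_ofNat] at h4
    rw [← h4]
    gcongr
  have h5 : eLpNorm (act T f) 2 μ ^ 2 ≤ ‖f‖ₑ ^ 2 := by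
    rw [h1, ← lintegral_sq_of_invariant hT f]
    exact lintegral_mono h2
  exact (ENNReal.pow_le_pow_left_iff two_ne_zero).1 h5

theorem memLp_act (hT : T.Invariant μ) (f : Lp ℝ 2 μ) : MemLp (act T f) 2 μ :=
  ⟨(stronglyMeasurable_act f).aestronglyMeasurable,
    (eLpNorm_act_le hT f).trans_lt enorm_lt_top⟩

/-- The bounded operator `f ↦ (x ↦ ∫ f(y) T(x, dy))` on `L²(μ)` given by a Markov kernel `T`
that leaves `μ` invariant. -/
def kernelOp (T : Kernel E E) [IsMarkovKernel T] (hT : T.Invariant μ) :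
    Lp ℝ 2 μ →L[ℝ] Lp ℝ 2 μ :=
  LinearMap.mkContinuous
    { toFun := fun f => (memLp_act hT f).toLp (act T f)
      map_add' := by
        intro f g
        rw [← MemLp.toLp_add]
        refine MemLp.toLp_congr _ _ ?_
        filter_upwards [ae_ae_of_invariant hT (Lp.coeFn_add f g), ae_integrable hT f,
          ae_integrable hT g] with x hx hf hg
        simp only [act, Pi.add_apply]
        rw [← integral_add hf hg]
        exact integral_congr_ae hx
      map_smul' := by
        intro c f
        rw [RingHom.id_apply, ← MemLp.toLp_const_smul]
        refine MemLp.toLp_congr _ _ ?_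
        filter_upwards [ae_ae_of_invariant hT (Lp.coeFn_smul c f)] with x hx
        simp only [act, Pi.smul_apply]
        rw [← integral_smul]
        exact integral_congr_ae hx }
    1 (by
      intro f
      simp only [LinearMap.coe_mk, AddHom.coe_mk, one_mul, Lp.norm_toLp]
      exact ENNReal.toReal_le_of_le_ofReal (norm_nonneg _)
        ((eLpNorm_act_le hT f).trans_eq (ofReal_norm f).symm))

theorem coeFn_kernelOp (hT : T.Invariant μ) (f : Lp ℝ 2 μ) :
    kernelOp T hT f =ᵐ[μ] fun x => ∫ y, f y ∂(T x) :=
  (memLp_act hT f).coeFn_toLp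

end Operator

variable {E : Type*} [MeasurableSpace E] {μ : Measure E}

/-- Membership in the space `L²₀(μ)` of elements of `L²(μ)` with `μ(f) = 0`. -/
def MeanZero (f : Lp ℝ 2 μ) : Prop := ∫ x, f x ∂μ = 0

/-- The oscillation `ess sup f - ess inf f`, computed in the extended reals. -/
def osc (f : Lp ℝ 2 μ) : ℝ≥0∞ :=
  (essSup (fun x => (f x : EReal)) μ - essInf (fun x => (f x : EReal)) μ).toENNReal

/-- The squared oscillation. -/
def oscSq (f : Lp ℝ 2 μ) : ℝ≥0∞ := osc f ^ 2

/-- The Dirichlet form `⟨(Id - T) f, f⟩`. -/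
def dirichlet (T : Lp ℝ 2 μ →L[ℝ] Lp ℝ 2 μ) (f : Lp ℝ 2 μ) : ℝ := inner ℝ (f - T f) f

/-- Sieve functionals on `L²(μ)`. -/
def IsSieve (Φ : Lp ℝ 2 μ → ℝ≥0∞) : Prop :=
  (∀ (f : Lp ℝ 2 μ) (c : ℝ), 0 < c → Φ (c • f) = ENNReal.ofReal (c ^ 2) * Φ f) ∧
  ∃ a : ℝ≥0, ∀ f : Lp ℝ 2 μ, MeanZero f → ‖f‖ₑ ^ 2 ≤ a * Φ f

/-- The `(Φ, α)`-weak Poincaré inequality; only the values of `α` on `(0, ∞)` matter. -/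
def AlphaWPI (Φ : Lp ℝ 2 μ → ℝ≥0∞) (α : ℝ → ℝ≥0) (T : Lp ℝ 2 μ →L[ℝ] Lp ℝ 2 μ) : Prop :=
  IsSieve Φ ∧ AntitoneOn α (Set.Ioi 0) ∧
  ∀ r : ℝ, 0 < r → ∀ f : Lp ℝ 2 μ, MeanZero f →
    ((‖f‖ ^ 2 : ℝ) : EReal) ≤
      ((α r * dirichlet T f : ℝ) : EReal) + (r : EReal) * (Φ f : EReal)

/-- The `(Φ, β)`-weak Poincaré inequality; only the values of `β` on `(0, ∞)` matter. -/
def BetaWPI (Φ : Lp ℝ 2 μ → ℝ≥0∞) (β : ℝ → ℝ≥0) (T : Lp ℝ 2 μ →L[ℝ] Lp ℝ 2 μ) : Prop :=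
  IsSieve Φ ∧ AntitoneOn β (Set.Ioi 0) ∧ Tendsto β atTop (𝓝 0) ∧
  ∀ s : ℝ, 0 < s → ∀ f : Lp ℝ 2 μ, MeanZero f →
    ((‖f‖ ^ 2 : ℝ) : EReal) ≤
      ((s * dirichlet T f : ℝ) : EReal) + ((β s : ℝ) : EReal) * (Φ f : EReal)

/-- A `Φ`-weak Poincaré inequality holds for `T`, in one of its two parametrizations. -/
def HasWPI (Φ : Lp ℝ 2 μ → ℝ≥0∞) (T : Lp ℝ 2 μ →L[ℝ] Lp ℝ 2 μ) : Prop :=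
  (∃ α : ℝ → ℝ≥0, AlphaWPI Φ α T) ∨ (∃ β : ℝ → ℝ≥0, BetaWPI Φ β T)

/-- `T` is `Φ`-convergent: `‖Tⁿ f‖² ≤ γ(n) Φ(f)` with `γ` decreasing to zero. -/
def IsConvergent (Φ : Lp ℝ 2 μ → ℝ≥0∞) (T : Lp ℝ 2 μ →L[ℝ] Lp ℝ 2 μ) : Prop :=
  ∃ γ : ℕ → ℝ≥0, Antitone γ ∧ Tendsto γ atTop (𝓝 0) ∧
    ∀ f : Lp ℝ 2 μ, MeanZero f → 0 < Φ f → Φ f < ∞ →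
      ∀ n : ℕ, 1 ≤ n → ‖(T ^ n) f‖ₑ ^ 2 ≤ γ n * Φ f

end

end MarkovWPI

namespace MarkovWPI

/-! ### Oscillation as a sieve, and its contraction under the kernel. -/

section Oscillation

variable {E : Type*} [MeasurableSpace E] {μ : Measure E}

/-! The Dirichlet form `dirichlet (kernelOp T hT) f` is half the mean squared increment of `f` over
one stationary step. Suppose centred functions bounded by 1 have summable Dirichlet forms. Then
their increments over any fixed number of steps are summable too, so for almost every `x` and every
`n` the differences `f k x - f k y` tend to zero for `T ^ n`-almost every `y`. Irreducibility from
one such `x` upgrades this to `μ`-almost every `y`. Centring then forces `f k x → 0`, and dominated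
convergence gives `‖f k‖ → 0` (`tendsto_norm_zero_of_tsum_dirichlet`). If the inequality failed for
some `r` with every constant, normalised counterexamples for the constants `4 ^ k` would contradict
this (`exists_norm_sq_le_of_isIrreducible`).

For the second half, the Dirichlet form of `T*T` is the mean conditional variance of `f` after one
step. Holding mass at least `δ` bounds that variance below by `δ` times the mean squared increment,
so the inequality passes from `T` to `T*T`. Since this form is also the loss `‖f‖² - ‖T f‖²`, and
`T` does not increase oscillation, iterating gives convergence at a rate uniform in `f`. -/

theorem osc_le_of_ae_mem_Icc {f : Lp ℝ 2 μ} {a b : ℝ} [IsProbabilityMeasure μ]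
    (h : ∀ᵐ x ∂μ, f x ∈ Set.Icc a b) : osc f ≤ ENNReal.ofReal (b - a) := by
  have h1 : essSup (fun x => (f x : EReal)) μ ≤ (b : EReal) :=
    essSup_le_of_ae_le _ (h.mono fun x hx => EReal.coe_le_coe_iff.2 hx.2)
  have h2 : (a : EReal) ≤ essInf (fun x => (f x : EReal)) μ :=
    le_essInf_of_ae_le _ (h.mono fun x hx => EReal.coe_le_coe_iff.2 hx.1)
  rw [← EReal.real_coe_toENNReal, EReal.coe_sub]
  exact EReal.toENNReal_le_toENNReal (EReal.sub_le_sub h1 h2)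

/-- A function of finite oscillation is bounded, and its oscillation is the length of an interval
that contains almost all its values. -/
theorem exists_ae_mem_Icc_of_osc_ne_top [IsProbabilityMeasure μ] {f : Lp ℝ 2 μ}
    (hf : osc f ≠ ∞) :
    ∃ a b : ℝ, a ≤ b ∧ (∀ᵐ x ∂μ, f x ∈ Set.Icc a b) ∧ osc f = ENNReal.ofReal (b - a) := by
  have h1 : ∀ᵐ x ∂μ, (f x : EReal) ≤ essSup (fun x => (f x : EReal)) μ := ae_le_essSup
  have h2 : ∀ᵐ x ∂μ, essInf (fun x => (f x : EReal)) μ ≤ (f x : EReal) := ae_essInf_le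
  -- One real value between the essential bounds excludes a supremum `⊥` and an infimum `⊤`; any
  -- other infinite bound makes the oscillation infinite.
  obtain ⟨x, hx1, hx2⟩ := (h1.and h2).exists
  have key : osc f = (essSup (fun x => (f x : EReal)) μ
    - essInf (fun x => (f x : EReal)) μ).toENNReal := rfl
  generalize essSup (fun x => (f x : EReal)) μ = S at *
  generalize essInf (fun x => (f x : EReal)) μ = I at *
  induction S with
  | bot => simp at hx1
  | top =>
    induction I with
    | top => simp at hx2
    | bot => simp [key] at hf
    | coe a => simp [key] at hf
  | coe b =>
    induction I with
    | top => simp at hx2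
    | bot => simp [key] at hf
    | coe a =>
      refine ⟨a, b, EReal.coe_le_coe_iff.1 (hx2.trans hx1), ?_, ?_⟩
      · filter_upwards [h1, h2] with y hy1 hy2
        exact ⟨EReal.coe_le_coe_iff.1 hy2, EReal.coe_le_coe_iff.1 hy1⟩
      · rw [key, ← EReal.coe_sub, EReal.real_coe_toENNReal]

theorem osc_smul_le [IsProbabilityMeasure μ] (f : Lp ℝ 2 μ) {c : ℝ} (hc : 0 < c) :
    osc (c • f) ≤ ENNReal.ofReal c * osc f := by
  by_cases hf : osc f = ∞
  · rw [hf, ENNReal.mul_top (by simpa using hc)]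
    exact le_top
  obtain ⟨a, b, -, h, hab⟩ := exists_ae_mem_Icc_of_osc_ne_top hf
  rw [hab, ← ENNReal.ofReal_mul hc.le, mul_sub]
  refine osc_le_of_ae_mem_Icc ?_
  filter_upwards [h, Lp.coeFn_smul c f] with x hx hcx
  rw [hcx, Pi.smul_apply, smul_eq_mul]
  exact ⟨mul_le_mul_of_nonneg_left hx.1 hc.le, mul_le_mul_of_nonneg_left hx.2 hc.le⟩

theorem osc_smul [IsProbabilityMeasure μ] (f : Lp ℝ 2 μ) {c : ℝ} (hc : 0 < c) :
    osc (c • f) = ENNReal.ofReal c * osc f := by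
  refine le_antisymm (osc_smul_le f hc) ?_
  -- Scaling back by `c⁻¹` turns the upper bound into the reverse one.
  have h := osc_smul_le (c • f) (inv_pos.2 hc)
  rw [smul_smul, inv_mul_cancel₀ hc.ne', one_smul] at h
  calc ENNReal.ofReal c * osc f
      ≤ ENNReal.ofReal c * (ENNReal.ofReal c⁻¹ * osc (c • f)) := by gcongr
    _ = osc (c • f) := by
      rw [← mul_assoc, ← ENNReal.ofReal_mul hc.le, mul_inv_cancel₀ hc.ne', ENNReal.ofReal_one,
        one_mul]

theorem oscSq_smul [IsProbabilityMeasure μ] (f : Lp ℝ 2 μ) {c : ℝ} (hc : 0 < c) :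
    oscSq (c • f) = ENNReal.ofReal (c ^ 2) * oscSq f := by
  rw [oscSq, oscSq, osc_smul f hc, mul_pow, ENNReal.ofReal_pow hc.le]

theorem integrable_coeFn [IsProbabilityMeasure μ] (f : Lp ℝ 2 μ) :
    Integrable (fun x => f x) μ :=
  (Lp.memLp f).integrable (by norm_num)

/-- A mean lies in any interval that carries almost all the values. Hence oscillation bounds `|f|`,
and with it the `L²` norm, for centred `f`. -/
theorem MeanZero.zero_mem_Icc [IsProbabilityMeasure μ] {f : Lp ℝ 2 μ} (hf : MeanZero f)
    {a b : ℝ} (h : ∀ᵐ x ∂μ, f x ∈ Set.Icc a b) : (0 : ℝ) ∈ Set.Icc a b := by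
  have h0 : ∫ x, f x ∂μ = 0 := hf
  constructor
  · have := integral_mono_ae (integrable_const a) (integrable_coeFn f) (h.mono fun x hx => hx.1)
    simpa [h0] using this
  · have := integral_mono_ae (integrable_coeFn f) (integrable_const b) (h.mono fun x hx => hx.2)
    simpa [h0] using this

theorem MeanZero.ae_enorm_le_osc [IsProbabilityMeasure μ] {f : Lp ℝ 2 μ} (hf : MeanZero f) :
    ∀ᵐ x ∂μ, ‖f x‖ₑ ≤ osc f := by
  by_cases hf' : osc f = ∞
  · simp [hf']
  obtain ⟨a, b, -, h, hab⟩ := exists_ae_mem_Icc_of_osc_ne_top hf'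
  have h0 := hf.zero_mem_Icc h
  filter_upwards [h] with x hx
  rw [hab, Real.enorm_eq_ofReal_abs]
  refine ENNReal.ofReal_le_ofReal (abs_le.2 ⟨?_, ?_⟩) <;> linarith [h0.1, h0.2, hx.1, hx.2]

theorem MeanZero.enorm_le_osc [IsProbabilityMeasure μ] {f : Lp ℝ 2 μ} (hf : MeanZero f) :
    ‖f‖ₑ ≤ osc f := by
  rw [Lp.enorm_def]
  refine (eLpNorm_le_of_ae_enorm_bound hf.ae_enorm_le_osc).trans ?_
  simp

theorem MeanZero.enorm_sq_le_oscSq [IsProbabilityMeasure μ] {f : Lp ℝ 2 μ} (hf : MeanZero f) :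
    ‖f‖ₑ ^ 2 ≤ oscSq f := by
  rw [oscSq]
  gcongr
  exact hf.enorm_le_osc

theorem isSieve_oscSq [IsProbabilityMeasure μ] : IsSieve (oscSq (μ := μ)) :=
  ⟨fun f _ hc => oscSq_smul f hc, 1, fun f hf => by simpa using hf.enorm_sq_le_oscSq⟩

variable {T : Kernel E E}

theorem integral_integral_of_invariant (hT : T.Invariant μ) {g : E → ℝ} (hg : Integrable g μ) :
    ∫ x, ∫ y, g y ∂(T x) ∂μ = ∫ y, g y ∂μ := by
  have h := Kernel.integral_comp (η := T) (κ := Kernel.const Unit μ) (a := ()) (f := g)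
    (by rwa [← Measure.comp_eq_comp_const_apply, hT.def])
  rw [← Measure.comp_eq_comp_const_apply, hT.def] at h
  simpa using h.symm

theorem integrable_integral_of_invariant (hT : T.Invariant μ) {g : E → ℝ} (hg : Integrable g μ) :
    Integrable (fun x => ∫ y, g y ∂(T x)) μ := by
  have h := Integrable.integral_comp (η := T) (κ := Kernel.const Unit μ) (a := ()) (f := g)
    (by rwa [← Measure.comp_eq_comp_const_apply, hT.def])
  simpa using h

variable [IsProbabilityMeasure μ] [IsMarkovKernel T]

/-- Averaging against a probability measure keeps values in the same interval, and by invariance `T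
x` sees that interval for almost every `x`. -/
theorem osc_kernelOp_le (hT : T.Invariant μ) (f : Lp ℝ 2 μ) : osc (kernelOp T hT f) ≤ osc f := by
  by_cases hf : osc f = ∞
  · simp [hf]
  obtain ⟨a, b, -, h, hab⟩ := exists_ae_mem_Icc_of_osc_ne_top hf
  rw [hab]
  refine osc_le_of_ae_mem_Icc ?_
  filter_upwards [coeFn_kernelOp hT f, ae_ae_of_invariant hT h, ae_integrable hT f]
    with x hx hmem hint
  rw [hx]
  constructor
  · have := integral_mono_ae (integrable_const a) hint (hmem.mono fun y hy => hy.1)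
    simpa using this
  · have := integral_mono_ae hint (integrable_const b) (hmem.mono fun y hy => hy.2)
    simpa using this

theorem oscSq_kernelOp_le (hT : T.Invariant μ) (f : Lp ℝ 2 μ) :
    oscSq (kernelOp T hT f) ≤ oscSq f := by
  rw [oscSq, oscSq]
  gcongr
  exact osc_kernelOp_le hT f

theorem MeanZero.map_kernelOp {f : Lp ℝ 2 μ} (hf : MeanZero f) (hT : T.Invariant μ) :
    MeanZero (kernelOp T hT f) := by
  rw [MeanZero, integral_congr_ae (coeFn_kernelOp hT f),
    integral_integral_of_invariant hT (integrable_coeFn f)]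
  exact hf

end Oscillation

end MarkovWPI

namespace MarkovWPI

/-! ### Dirichlet forms of `T` and `T*T`, and their comparison under holding. -/

section DirichletForm

variable {E : Type*} [MeasurableSpace E] {μ : Measure E} {T : Kernel E E}
  [IsMarkovKernel T]

theorem integrable_sq_coeFn (f : Lp ℝ 2 μ) : Integrable (fun x => f x ^ 2) μ :=
  (Lp.memLp f).integrable_sq

theorem norm_sq_eq_integral (f : Lp ℝ 2 μ) : ‖f‖ ^ 2 = ∫ x, f x ^ 2 ∂μ := by
  rw [← real_inner_self_eq_norm_sq, L2.inner_def]
  simp [pow_two]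

theorem inner_eq_integral (f g : Lp ℝ 2 μ) : inner ℝ f g = ∫ x, f x * g x ∂μ := by
  rw [L2.inner_def]
  simp [mul_comm]

theorem dirichlet_eq (S : Lp ℝ 2 μ →L[ℝ] Lp ℝ 2 μ) (f : Lp ℝ 2 μ) :
    dirichlet S f = ‖f‖ ^ 2 - inner ℝ (S f) f := by
  rw [dirichlet, inner_sub_left, real_inner_self_eq_norm_sq]

/-- This identifies the form with the squared norm lost in one step, which drives the decay of `‖T ^
n f‖`. -/
theorem dirichlet_adjoint_comp_self (S : Lp ℝ 2 μ →L[ℝ] Lp ℝ 2 μ) (f : Lp ℝ 2 μ) :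
    dirichlet (ContinuousLinearMap.adjoint S ∘L S) f = ‖f‖ ^ 2 - ‖S f‖ ^ 2 := by
  rw [dirichlet_eq, ContinuousLinearMap.comp_apply, ContinuousLinearMap.adjoint_inner_left,
    real_inner_self_eq_norm_sq]

theorem dirichlet_smul (S : Lp ℝ 2 μ →L[ℝ] Lp ℝ 2 μ) (f : Lp ℝ 2 μ) (c : ℝ) :
    dirichlet S (c • f) = c ^ 2 * dirichlet S f := by
  simp only [dirichlet, map_smul, ← smul_sub, real_inner_smul_left, real_inner_smul_right]
  ring

theorem integral_sub_sq_eq {ν : Measure E} [IsProbabilityMeasure ν] {g : E → ℝ}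
    (hg : MemLp g 2 ν) (c : ℝ) :
    ∫ y, (c - g y) ^ 2 ∂ν = c ^ 2 - 2 * (c * ∫ y, g y ∂ν) + ∫ y, g y ^ 2 ∂ν := by
  have h1 : Integrable g ν := hg.integrable (by norm_num)
  have h2 : ∀ y, (c - g y) ^ 2 = (c ^ 2 - 2 * c * g y) + g y ^ 2 := fun y => by ring
  have h3 : Integrable (fun y => 2 * c * g y) ν := h1.const_mul _
  have h4 : Integrable (fun y => c ^ 2 - 2 * c * g y) ν := (integrable_const _).sub h3
  simp_rw [h2]
  rw [integral_add h4 hg.integrable_sq,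
    integral_sub (integrable_const _) h3, integral_const_mul]
  simp
  ring

theorem ae_integral_sub_sq_eq (hT : T.Invariant μ) (f : Lp ℝ 2 μ) :
    (fun x => ∫ y, (f x - f y) ^ 2 ∂(T x)) =ᵐ[μ]
      fun x => f x ^ 2 - 2 * (f x * kernelOp T hT f x) + ∫ y, f y ^ 2 ∂(T x) := by
  filter_upwards [ae_memLp hT f, coeFn_kernelOp hT f] with x hx hTx
  rw [integral_sub_sq_eq hx, hTx]

theorem integrable_mul_coeFn (f g : Lp ℝ 2 μ) : Integrable (fun x => f x * g x) μ :=
  (Lp.memLp f).integrable_mul (Lp.memLp g)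

theorem integrable_integral_sub_sq (hT : T.Invariant μ) (f : Lp ℝ 2 μ) :
    Integrable (fun x => ∫ y, (f x - f y) ^ 2 ∂(T x)) μ := by
  refine Integrable.congr ?_ (ae_integral_sub_sq_eq hT f).symm
  exact ((integrable_sq_coeFn f).sub ((integrable_mul_coeFn f _).const_mul 2)).add
    (integrable_integral_of_invariant hT (integrable_sq_coeFn f))

/-- The Dirichlet form as a mean squared increment over one step of the chain. -/
theorem integral_integral_sub_sq (hT : T.Invariant μ) (f : Lp ℝ 2 μ) :
    ∫ x, ∫ y, (f x - f y) ^ 2 ∂(T x) ∂μ = 2 * dirichlet (kernelOp T hT) f := by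
  have h1 := (integrable_mul_coeFn f (kernelOp T hT f)).const_mul 2
  have h2 : Integrable (fun x => f x ^ 2 - 2 * (f x * kernelOp T hT f x)) μ :=
    (integrable_sq_coeFn f).sub h1
  rw [integral_congr_ae (ae_integral_sub_sq_eq hT f),
    integral_add h2 (integrable_integral_of_invariant hT (integrable_sq_coeFn f)),
    integral_sub (integrable_sq_coeFn f) h1, integral_const_mul,
    integral_integral_of_invariant hT (integrable_sq_coeFn f), ← norm_sq_eq_integral,
    ← inner_eq_integral, dirichlet_eq, real_inner_comm]
  ring

theorem dirichlet_nonneg (hT : T.Invariant μ) (f : Lp ℝ 2 μ) :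
    0 ≤ dirichlet (kernelOp T hT) f := by
  have h : 0 ≤ ∫ x, ∫ y, (f x - f y) ^ 2 ∂(T x) ∂μ :=
    integral_nonneg fun x => integral_nonneg fun y => sq_nonneg _
  rw [integral_integral_sub_sq hT] at h
  linarith

theorem lintegral_lintegral_sub_sq (hT : T.Invariant μ) (f : Lp ℝ 2 μ) :
    ∫⁻ x, ∫⁻ y, ‖f x - f y‖ₑ ^ 2 ∂(T x) ∂μ
      = ENNReal.ofReal (2 * dirichlet (kernelOp T hT) f) := by
  rw [← integral_integral_sub_sq hT, ofReal_integral_eq_lintegral_ofReal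
    (integrable_integral_sub_sq hT f)
    (Eventually.of_forall fun x => integral_nonneg fun y => sq_nonneg _)]
  refine lintegral_congr_ae ?_
  filter_upwards [ae_memLp hT f] with x hx
  rw [ofReal_integral_eq_lintegral_ofReal]
  · refine lintegral_congr fun y => ?_
    rw [← sq_abs, ENNReal.ofReal_pow (abs_nonneg _), Real.enorm_eq_ofReal_abs]
  · exact ((memLp_const (f x)).sub hx).integrable_sq
  · exact Eventually.of_forall fun y => sq_nonneg _

/-- If `ν` charges `x` with mass at least `δ`, the variance under `ν` dominates `δ` times the mean
squared distance to the value at `x`. -/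
theorem mul_integral_sub_sq_le_variance {ν : Measure E} [IsProbabilityMeasure ν]
    [MeasurableSingletonClass E] {g : E → ℝ} (hg : MemLp g 2 ν) {x : E} {δ : ℝ}
    (hδ : δ ≤ ν.real {x}) :
    δ * ∫ y, (g x - g y) ^ 2 ∂ν ≤ ∫ y, g y ^ 2 ∂ν - (∫ y, g y ∂ν) ^ 2 := by
  set c := g x
  have hsub : MemLp (fun y => c - g y) 2 ν := (memLp_const c).sub hg
  have hint : Integrable (fun y => c - g y) ν := hsub.integrable (by norm_num)
  have hm : ∫ y, (c - g y) ∂ν = c - ∫ y, g y ∂ν := by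
    rw [integral_sub (integrable_const _) (hg.integrable (by norm_num))]
    simp
  have hexp := integral_sub_sq_eq hg c
  set q := ∫ y, (c - g y) ^ 2 ∂ν
  set m := ∫ y, (c - g y) ∂ν
  have hq0 : 0 ≤ q := integral_nonneg fun y => sq_nonneg _
  -- Cauchy-Schwarz on the complement of `{x}`
  have hcs : m ^ 2 ≤ (1 - ν.real {x}) * q := by
    -- Since `c - g` vanishes at `x`, this quadratic is the integral of the square of `c - g` minus
    -- `t` times the indicator of the complement of `{x}`. Its discriminant is therefore
    -- nonpositive.
    have h0 : ∀ t : ℝ, 0 ≤ (1 - ν.real {x}) * (t * t) + (-2 * m) * t + q := by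
      intro t
      have h1 : ∀ y, (c - g y - t * ({x}ᶜ : Set E).indicator 1 y) ^ 2
          = ((c - g y) ^ 2 - 2 * t * (c - g y)) + t ^ 2 * ({x}ᶜ : Set E).indicator 1 y := by
        intro y
        by_cases hy : y = x
        · simp [hy, c]
        · simp [hy]
          ring
      have h2 : Integrable (({x}ᶜ : Set E).indicator (1 : E → ℝ)) ν :=
        (integrable_const (1 : ℝ)).indicator (measurableSet_singleton x).compl
      have h3 : 0 ≤ ∫ y, (c - g y - t * ({x}ᶜ : Set E).indicator 1 y) ^ 2 ∂ν :=
        integral_nonneg fun y => sq_nonneg _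
      have h4 : Integrable (fun y => (c - g y) ^ 2 - 2 * t * (c - g y)) ν :=
        hsub.integrable_sq.sub (hint.const_mul _)
      simp_rw [h1] at h3
      rw [integral_add h4 (h2.const_mul _),
        integral_sub hsub.integrable_sq (hint.const_mul _), integral_const_mul,
        integral_const_mul, integral_indicator_one (measurableSet_singleton x).compl,
        probReal_compl_eq_one_sub (measurableSet_singleton x)] at h3
      linarith
    have := discrim_le_zero h0
    rw [discrim] at this
    linarith
  have : δ * q ≤ ν.real {x} * q := mul_le_mul_of_nonneg_right hδ hq0
  have hg1 : ∫ y, g y ∂ν = c - m := by rw [hm]; ring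
  -- Variance is unchanged by `g ↦ c - g`, so it equals `q - m ^ 2`, which is at least `ν.real {x} *
  -- q`.
  rw [hg1] at hexp ⊢
  nlinarith

/-- By invariance `‖f‖² - ‖T f‖²` is the `μ`-average of the variance of `f` under `T x`, to which
the pointwise variance bound applies. -/
theorem two_mul_dirichlet_le_dirichlet_adjoint [MeasurableSingletonClass E]
    (hT : T.Invariant μ) {δ : ℝ} (hδ : ∀ᵐ x ∂μ, δ ≤ (T x).real {x}) (f : Lp ℝ 2 μ) :
    δ * (2 * dirichlet (kernelOp T hT) f) ≤
      dirichlet (ContinuousLinearMap.adjoint (kernelOp T hT) ∘L kernelOp T hT) f := by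
  rw [dirichlet_adjoint_comp_self, norm_sq_eq_integral, norm_sq_eq_integral,
    ← integral_integral_sub_sq hT, ← integral_const_mul,
    ← integral_integral_of_invariant hT (integrable_sq_coeFn f),
    ← integral_sub (integrable_integral_of_invariant hT (integrable_sq_coeFn f))
      (integrable_sq_coeFn _)]
  refine integral_mono_ae ((integrable_integral_sub_sq hT f).const_mul δ)
    ((integrable_integral_of_invariant hT (integrable_sq_coeFn f)).sub (integrable_sq_coeFn _)) ?_
  filter_upwards [ae_memLp hT f, coeFn_kernelOp hT f, hδ] with x hx hTx hδx
  rw [hTx]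
  exact mul_integral_sub_sq_le_variance hx hδx

end DirichletForm

end MarkovWPI

namespace MarkovWPI

/-! ### Multi-step increments and the use of irreducibility. -/

section Increments

variable {E : Type*} [MeasurableSpace E] {μ : Measure E} {T : Kernel E E}

theorem invariant_pow (hT : T.Invariant μ) (n : ℕ) : (T ^ n).Invariant μ := by
  induction n with
  | zero =>
    rw [pow_zero, Kernel.Invariant]
    exact Measure.id_comp
  | succ n ih =>
    rw [pow_succ']
    exact hT.comp ih

instance isMarkovKernel_pow [IsMarkovKernel T] (n : ℕ) : IsMarkovKernel (T ^ n) := by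
  induction n with
  | zero =>
    rw [pow_zero]
    exact inferInstanceAs (IsMarkovKernel Kernel.id)
  | succ n ih =>
    rw [pow_succ']
    change IsMarkovKernel (T ∘ₖ (T ^ n))
    infer_instance

theorem enorm_sub_sq_le (a b c : ℝ) :
    ‖a - c‖ₑ ^ 2 ≤ 2 * ‖a - b‖ₑ ^ 2 + 2 * ‖b - c‖ₑ ^ 2 := by
  have h : ∀ x : ℝ, ‖x‖ₑ ^ 2 = ENNReal.ofReal (x ^ 2) := fun x => by
    rw [Real.enorm_eq_ofReal_abs, ← ENNReal.ofReal_pow (abs_nonneg _), sq_abs]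
  have h2 : (2 : ℝ≥0∞) = ENNReal.ofReal 2 := by simp
  rw [h, h, h, h2, ← ENNReal.ofReal_mul (by norm_num), ← ENNReal.ofReal_mul (by norm_num),
    ← ENNReal.ofReal_add (by positivity) (by positivity)]
  refine ENNReal.ofReal_le_ofReal ?_
  -- The difference of the two sides is exactly this square.
  nlinarith [sq_nonneg (a - 2 * b + c)]

/-- The mean squared increment of `g` over `n` steps of the stationary chain. -/
noncomputable def increment (μ : Measure E) (T : Kernel E E) (n : ℕ) (g : E → ℝ) : ℝ≥0∞ :=
  ∫⁻ x, ∫⁻ y, ‖g x - g y‖ₑ ^ 2 ∂((T ^ n) x) ∂μ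

theorem measurable_enorm_sub_sq {g : E → ℝ} (hg : Measurable g) :
    Measurable fun p : E × E => ‖g p.1 - g p.2‖ₑ ^ 2 := by
  fun_prop

/-- Insert the position after `n` steps. By invariance it has law `μ`, so the last step contributes
a one-step stationary increment. -/
theorem increment_succ_le [IsMarkovKernel T] (hT : T.Invariant μ) (n : ℕ) {g : E → ℝ}
    (hg : Measurable g) :
    increment μ T (n + 1) g ≤ 2 * increment μ T n g + 2 * increment μ T 1 g := by
  have hm := measurable_enorm_sub_sq hg
  have hm1 : Measurable fun y => ∫⁻ z, ‖g y - g z‖ₑ ^ 2 ∂(T y) := hm.lintegral_kernel_prod_right'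
  have hmn : Measurable fun x => ∫⁻ y, ‖g x - g y‖ₑ ^ 2 ∂((T ^ n) x) :=
    hm.lintegral_kernel_prod_right'
  calc increment μ T (n + 1) g
      = ∫⁻ x, ∫⁻ y, ∫⁻ z, ‖g x - g z‖ₑ ^ 2 ∂(T y) ∂((T ^ n) x) ∂μ := by
        rw [increment, pow_succ']
        refine lintegral_congr fun x => ?_
        exact Kernel.lintegral_comp T (T ^ n) x (by fun_prop)
    _ ≤ ∫⁻ x, ∫⁻ y, (2 * ‖g x - g y‖ₑ ^ 2 + 2 * ∫⁻ z, ‖g y - g z‖ₑ ^ 2 ∂(T y))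
          ∂((T ^ n) x) ∂μ := by
        refine lintegral_mono fun x => lintegral_mono fun y => ?_
        refine (lintegral_mono fun z => enorm_sub_sq_le (g x) (g y) (g z)).trans ?_
        rw [lintegral_add_left measurable_const, lintegral_const, measure_univ, mul_one,
          lintegral_const_mul _ (by fun_prop)]
    _ = ∫⁻ x, (2 * ∫⁻ y, ‖g x - g y‖ₑ ^ 2 ∂((T ^ n) x)
          + 2 * ∫⁻ y, ∫⁻ z, ‖g y - g z‖ₑ ^ 2 ∂(T y) ∂((T ^ n) x)) ∂μ := by
        refine lintegral_congr fun x => ?_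
        rw [lintegral_add_right _ (hm1.const_mul 2), lintegral_const_mul _ (by fun_prop),
          lintegral_const_mul _ hm1]
    _ = 2 * increment μ T n g + 2 * increment μ T 1 g := by
        rw [lintegral_add_left (hmn.const_mul 2), lintegral_const_mul _ hmn,
          lintegral_const_mul _ hm1.lintegral_kernel,
          lintegral_lintegral_of_invariant (invariant_pow hT n) hm1, increment, increment, pow_one]

/-- The constant is crude, but only its finiteness for each fixed `n` is used. -/
theorem increment_le [IsMarkovKernel T] (hT : T.Invariant μ) (n : ℕ) {g : E → ℝ}
    (hg : Measurable g) : increment μ T n g ≤ 4 ^ n * increment μ T 1 g := by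
  induction n with
  | zero =>
    have h : increment μ T 0 g = 0 := by
      rw [increment, pow_zero]
      refine (lintegral_congr fun x => ?_).trans lintegral_zero
      change ∫⁻ y, ‖g x - g y‖ₑ ^ 2 ∂(Kernel.id x) = 0
      rw [Kernel.id_apply, lintegral_dirac' _ (by fun_prop)]
      simp
    simp [h]
  | succ n ih =>
    calc increment μ T (n + 1) g ≤ 2 * increment μ T n g + 2 * increment μ T 1 g :=
          increment_succ_le hT n hg
      _ ≤ 2 * (4 ^ n * increment μ T 1 g) + 2 * (4 ^ n * increment μ T 1 g) := by
        gcongr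
        exact le_mul_of_one_le_left zero_le (one_le_pow₀ (by norm_num))
      _ = 4 ^ (n + 1) * increment μ T 1 g := by ring

theorem increment_one_eq [IsMarkovKernel T] (hT : T.Invariant μ) (f : Lp ℝ 2 μ) :
    increment μ T 1 (fun x => f x) = ENNReal.ofReal (2 * dirichlet (kernelOp T hT) f) := by
  rw [increment, pow_one, lintegral_lintegral_sub_sq hT]

theorem ae_tsum_ne_top_of_increment [IsMarkovKernel T] {g : ℕ → E → ℝ}
    (hg : ∀ k, Measurable (g k)) {n : ℕ} (h : ∑' k, increment μ T n (g k) ≠ ∞) :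
    ∀ᵐ x ∂μ, ∀ᵐ y ∂((T ^ n) x), ∑' k, ‖g k x - g k y‖ₑ ^ 2 ≠ ∞ := by
  have hm : ∀ k, Measurable fun p : E × E => ‖g k p.1 - g k p.2‖ₑ ^ 2 :=
    fun k => measurable_enorm_sub_sq (hg k)
  have hF : ∫⁻ x, ∫⁻ y, ∑' k, ‖g k x - g k y‖ₑ ^ 2 ∂((T ^ n) x) ∂μ
      = ∑' k, increment μ T n (g k) := by
    simp only [increment]
    rw [← lintegral_tsum fun k => (hm k).lintegral_kernel_prod_right'.aemeasurable]
    refine lintegral_congr fun x => ?_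
    exact lintegral_tsum fun k => ((hm k).comp measurable_prodMk_left).aemeasurable
  have hms : Measurable fun p : E × E => ∑' k, ‖g k p.1 - g k p.2‖ₑ ^ 2 :=
    Measurable.tsum hm
  rw [← hF] at h
  filter_upwards [ae_lt_top hms.lintegral_kernel_prod_right' h] with x hx
  exact (ae_lt_top (hms.comp measurable_prodMk_left) hx.ne).mono fun y hy => hy.ne

variable [IsProbabilityMeasure μ] [IsMarkovKernel T]

/-- For an irreducible chain, bounded centred functions with summable Dirichlet forms converge to
zero in norm. -/
theorem tendsto_norm_zero_of_tsum_dirichlet (hT : T.Invariant μ) (hirr : Kernel.IsIrreducible μ T)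
    {f : ℕ → Lp ℝ 2 μ} (h0 : ∀ k, MeanZero (f k)) (hb : ∀ k, ∀ᵐ x ∂μ, ‖f k x‖ ≤ 1)
    (hs : ∑' k, ENNReal.ofReal (2 * dirichlet (kernelOp T hT) (f k)) ≠ ∞) :
    Tendsto (fun k => ‖f k‖ ^ 2) atTop (𝓝 0) := by
  have hmeas : ∀ k, Measurable fun x => f k x := fun k => (Lp.stronglyMeasurable (f k)).measurable
  have hsum : ∀ n, ∑' k, increment μ T n (fun x => f k x) ≠ ∞ := by
    intro n
    refine ne_top_of_le_ne_top (ENNReal.mul_ne_top (a := 4 ^ n) (by finiteness) hs) ?_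
    rw [← ENNReal.tsum_mul_left]
    refine ENNReal.tsum_le_tsum fun k => ?_
    rw [← increment_one_eq]
    exact increment_le hT n (hmeas k)
  -- Only countably many null sets are discarded, so one starting point serves all `n` and `k`.
  obtain ⟨x, hx1, hxb⟩ := ((ae_all_iff.2 fun n =>
    ae_tsum_ne_top_of_increment hmeas (hsum n)).and (ae_all_iff.2 hb)).exists
  have hμ : ∀ᵐ y ∂μ, ∑' k, ‖f k x - f k y‖ₑ ^ 2 ≠ ∞ := by
    have hA : MeasurableSet {y | ∑' k, ‖f k x - f k y‖ₑ ^ 2 = ∞} :=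
      (Measurable.tsum fun k =>
        ((measurable_const.sub (hmeas k)).enorm.pow_const 2)) (measurableSet_singleton ∞)
    rw [ae_iff]
    simp only [ne_eq, not_not]
    by_contra hpos
    -- A divergence set of positive `μ`-measure would be charged by some `T ^ n` from this `x`,
    -- where it is null for every `n`.
    obtain ⟨n, hn⟩ := hirr.irreducible hA (pos_iff_ne_zero.2 hpos) x
    have := hx1 n
    rw [ae_iff] at this
    simp only [ne_eq, not_not] at this
    exact hn.ne' this
  have hlim : ∀ᵐ y ∂μ, Tendsto (fun k => f k x - f k y) atTop (𝓝 0) := by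
    filter_upwards [hμ] with y hy
    have h1 := ENNReal.tendsto_atTop_zero_of_tsum_ne_top hy
    rw [tendsto_zero_iff_norm_tendsto_zero]
    have h2 := (ENNReal.tendsto_toReal ENNReal.zero_ne_top).comp h1
    simp only [Function.comp_def, ENNReal.toReal_pow, toReal_enorm, ENNReal.toReal_zero] at h2
    have h3 := (Real.continuous_sqrt.tendsto 0).comp h2
    simpa [Function.comp_def, Real.sqrt_sq_eq_abs] using h3
  -- Because `f k` is centred, integrating `f k x - f k y` over `y` returns `f k x`; the bound 2
  -- dominates.
  have hx0 : Tendsto (fun k => f k x) atTop (𝓝 0) := by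
    have h := tendsto_integral_of_dominated_convergence (μ := μ) (F := fun k y => f k x - f k y)
      (f := fun _ => 0) (fun _ => 2)
      (fun k => (measurable_const.sub (hmeas k)).aestronglyMeasurable) (integrable_const _)
      (fun k => by
        filter_upwards [hb k] with y hy
        exact (norm_sub_le _ _).trans (by linarith [hxb k])) hlim
    refine (h.congr fun k => ?_).trans (by simp)
    rw [integral_sub (integrable_const _) (integrable_coeFn _), show ∫ y, f k y ∂μ = 0 from h0 k]
    simp
  have h := tendsto_integral_of_dominated_convergence (μ := μ) (F := fun k y => f k y ^ 2)
    (f := fun _ => 0) (fun _ => 1)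
    (fun k => ((hmeas k).pow_const 2).aestronglyMeasurable) (integrable_const _)
    (fun k => by
      filter_upwards [hb k] with y hy
      rw [norm_pow]
      exact pow_le_one₀ (norm_nonneg _) hy)
    (by
      filter_upwards [hlim] with y hy
      simpa using (hx0.sub hy).pow 2)
  simpa [norm_sq_eq_integral] using h

/-- Weak Poincaré inequalities for functions of finite oscillation, without monotonicity of the
constant. -/
theorem exists_norm_sq_le_of_isIrreducible (hT : T.Invariant μ)
    (hirr : Kernel.IsIrreducible μ T) {r : ℝ} (hr : 0 < r) :
    ∃ C : ℝ≥0, ∀ f : Lp ℝ 2 μ, MeanZero f → oscSq f ≠ ∞ →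
      ‖f‖ ^ 2 ≤ C * dirichlet (kernelOp T hT) f + r * (oscSq f).toReal := by
  by_contra! hcon
  -- Geometric constants make the Dirichlet forms of the normalised counterexamples at most `(1 / 4)
  -- ^ k`, hence summable.
  choose! f h0 hfin hlt using fun k : ℕ => hcon (4 ^ k)
  have hosc : ∀ k, osc (f k) ≠ ∞ := fun k h => hfin k (by simp [oscSq, h])
  set c : ℕ → ℝ := fun k => (osc (f k)).toReal
  have hΦ : ∀ k, (oscSq (f k)).toReal = c k ^ 2 := fun k => by simp [oscSq, c]
  have hD : ∀ k, 0 ≤ dirichlet (kernelOp T hT) (f k) := fun k => dirichlet_nonneg hT _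
  have hle : ∀ k, ‖f k‖ ≤ c k := fun k => by
    have := ENNReal.toReal_mono (hosc k) (h0 k).enorm_le_osc
    simpa using this
  have hc : ∀ k, 0 < c k := by
    intro k
    refine lt_of_le_of_ne ENNReal.toReal_nonneg fun hck => ?_
    have h1 := hlt k
    have h2 : ‖f k‖ = 0 := le_antisymm ((hle k).trans_eq hck.symm) (norm_nonneg _)
    rw [h2, hΦ, ← hck] at h1
    push_cast at h1
    have h3 : 0 ≤ (4 : ℝ) ^ k * dirichlet (kernelOp T hT) (f k) :=
      mul_nonneg (by positivity) (hD k)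
    simp only [ne_eq, OfNat.ofNat_ne_zero, not_false_eq_true, zero_pow, mul_zero, add_zero] at h1
    linarith
  have hnorm : ∀ k, ‖(c k)⁻¹ • f k‖ ^ 2 = (c k ^ 2)⁻¹ * ‖f k‖ ^ 2 := fun k => by
    rw [norm_smul, mul_pow, norm_inv, inv_pow, Real.norm_eq_abs, sq_abs]
  have hdir : ∀ k, dirichlet (kernelOp T hT) ((c k)⁻¹ • f k) ≤ (1 / 4) ^ k := by
    intro k
    have h1 := hlt k
    rw [hΦ] at h1
    push_cast at h1
    have h2 : ‖f k‖ ^ 2 ≤ c k ^ 2 := pow_le_pow_left₀ (norm_nonneg _) (hle k) 2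
    have h3 : (4 : ℝ) ^ k * dirichlet (kernelOp T hT) (f k) ≤ c k ^ 2 := by
      nlinarith [mul_pos hr (pow_pos (hc k) 2)]
    rw [dirichlet_smul, inv_pow, one_div, inv_pow, inv_mul_le_iff₀ (pow_pos (hc k) 2),
      ← div_eq_mul_inv, le_div_iff₀ (by positivity)]
    linarith
  -- Dropping the nonnegative Dirichlet term leaves norms bounded below, the property that
  -- contradicts convergence to zero.
  have hlow : ∀ k, r ≤ ‖(c k)⁻¹ • f k‖ ^ 2 := by
    intro k
    have h1 := hlt k
    rw [hΦ] at h1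
    push_cast at h1
    have h2 : 0 ≤ (4 : ℝ) ^ k * dirichlet (kernelOp T hT) (f k) :=
      mul_nonneg (by positivity) (hD k)
    rw [hnorm, le_inv_mul_iff₀ (pow_pos (hc k) 2)]
    linarith
  have hlim := tendsto_norm_zero_of_tsum_dirichlet hT hirr (f := fun k => (c k)⁻¹ • f k)
    (fun k => by
      have h : ∫ x, f k x ∂μ = 0 := h0 k
      rw [MeanZero, integral_congr_ae (Lp.coeFn_smul _ _)]
      simp only [Pi.smul_apply]
      rw [integral_smul, h, smul_zero])
    (fun k => by
      filter_upwards [Lp.coeFn_smul (c k)⁻¹ (f k), (h0 k).ae_enorm_le_osc] with x hx hxo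
      have h1 := ENNReal.toReal_mono (hosc k) hxo
      rw [toReal_enorm] at h1
      rw [hx, Pi.smul_apply, norm_smul, norm_inv, Real.norm_of_nonneg (hc k).le,
        inv_mul_le_iff₀ (hc k), mul_one]
      exact h1)
    (by
      have hsum : Summable fun k : ℕ => 2 * (1 / 4 : ℝ) ^ k :=
        (summable_geometric_of_lt_one (by norm_num) (by norm_num)).mul_left 2
      refine ne_top_of_le_ne_top hsum.tsum_ofReal_ne_top ?_
      refine ENNReal.tsum_le_tsum fun k => ENNReal.ofReal_le_ofReal ?_
      linarith [hdir k])
  exact absurd (ge_of_tendsto' hlim hlow) (not_le.2 hr)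

end Increments

end MarkovWPI

namespace MarkovWPI

/-! ### From families of inequalities to weak Poincaré inequalities and convergence. -/

section Convergence

variable {E : Type*} [MeasurableSpace E] {μ : Measure E}

/-- A family of inequalities with arbitrary constants yields a weak Poincaré inequality: taking
the least constants makes them decreasing. -/
theorem hasWPI_of_forall_exists {Φ : Lp ℝ 2 μ → ℝ≥0∞} (hΦ : IsSieve Φ)
    {S : Lp ℝ 2 μ →L[ℝ] Lp ℝ 2 μ}
    (h : ∀ r : ℝ, 0 < r → ∃ C : ℝ≥0, ∀ f : Lp ℝ 2 μ, MeanZero f → Φ f ≠ ∞ →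
      ‖f‖ ^ 2 ≤ C * dirichlet S f + r * (Φ f).toReal) :
    HasWPI Φ S := by
  let A : ℝ → Set ℝ≥0 := fun r => {C | ∀ f : Lp ℝ 2 μ, MeanZero f → Φ f ≠ ∞ →
    ‖f‖ ^ 2 ≤ C * dirichlet S f + r * (Φ f).toReal}
  have hclosed : ∀ r, IsClosed (A r) := by
    intro r
    have hA : A r = ⋂ (f : Lp ℝ 2 μ) (_ : MeanZero f) (_ : Φ f ≠ ∞),
        {C : ℝ≥0 | ‖f‖ ^ 2 ≤ C * dirichlet S f + r * (Φ f).toReal} := by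
      ext C
      simp [A]
    rw [hA]
    exact isClosed_iInter fun f => isClosed_iInter fun _ => isClosed_iInter fun _ =>
      isClosed_le (by fun_prop) (by fun_prop)
  -- The admissible constants form a closed set, so the least one is itself admissible.
  have hmem : ∀ r, 0 < r → sInf (A r) ∈ A r := fun r hr =>
    (hclosed r).csInf_mem (h r hr) (OrderBot.bddBelow _)
  refine Or.inl ⟨fun r => sInf (A r), hΦ, ?_, ?_⟩
  · intro r hr s hs hrs
    refine csInf_le_csInf (OrderBot.bddBelow _) (h r hr) fun C hC f hf hfin => ?_
    refine (hC f hf hfin).trans ?_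
    gcongr
  · intro r hr f hf
    by_cases hfin : Φ f = ∞
    -- With infinite sieve value the right side is `⊤` because `r > 0`.
    · rw [hfin, EReal.coe_ennreal_top, EReal.coe_mul_top_of_pos hr, EReal.coe_add_top]
      exact le_top
    · have h1 := hmem r hr f hf hfin
      rw [← EReal.coe_ennreal_toReal hfin, ← EReal.coe_mul, ← EReal.coe_add]
      exact EReal.coe_le_coe_iff.2 h1

variable {T : Kernel E E} [IsMarkovKernel T]

theorem norm_kernelOp_le (hT : T.Invariant μ) (f : Lp ℝ 2 μ) : ‖kernelOp T hT f‖ ≤ ‖f‖ := by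
  have h := (kernelOp T hT).le_of_opNorm_le (LinearMap.mkContinuous_norm_le _ zero_le_one _) f
  simpa using h

theorem norm_kernelOp_pow_succ_le (hT : T.Invariant μ) (n : ℕ) (f : Lp ℝ 2 μ) :
    ‖(kernelOp T hT ^ (n + 1)) f‖ ≤ ‖(kernelOp T hT ^ n) f‖ := by
  rw [pow_succ', mul_apply_eq_comp]
  exact norm_kernelOp_le hT _

theorem norm_kernelOp_pow_le (hT : T.Invariant μ) (n : ℕ) (f : Lp ℝ 2 μ) :
    ‖(kernelOp T hT ^ n) f‖ ≤ ‖f‖ := by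
  induction n with
  | zero => simp
  | succ n ih => exact (norm_kernelOp_pow_succ_le hT n f).trans ih

variable [IsProbabilityMeasure μ]

theorem MeanZero.map_kernelOp_pow {f : Lp ℝ 2 μ} (hf : MeanZero f) (hT : T.Invariant μ) (n : ℕ) :
    MeanZero ((kernelOp T hT ^ n) f) := by
  induction n with
  | zero => exact hf
  | succ n ih =>
    rw [pow_succ', mul_apply_eq_comp]
    exact ih.map_kernelOp hT

theorem oscSq_kernelOp_pow_le (hT : T.Invariant μ) (n : ℕ) (f : Lp ℝ 2 μ) :
    oscSq ((kernelOp T hT ^ n) f) ≤ oscSq f := by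
  induction n with
  | zero => rfl
  | succ n ih =>
    rw [pow_succ', mul_apply_eq_comp]
    exact (oscSq_kernelOp_le hT _).trans ih

theorem norm_sq_le_toReal_oscSq {f : Lp ℝ 2 μ} (hf : MeanZero f) (hfin : oscSq f ≠ ∞) :
    ‖f‖ ^ 2 ≤ (oscSq f).toReal := by
  have h := ENNReal.toReal_mono hfin hf.enorm_sq_le_oscSq
  simpa using h

/-- While the squared norm exceeds `2 * r * φ`, each step loses an amount whose product with `C` is
at least `r * φ`. The initial squared norm is at most `φ`, so this cannot last for more than `C / r`
steps. Keeping `C` as a factor avoids dividing by zero. -/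
theorem norm_sq_kernelOp_pow_le (hT : T.Invariant μ) {r : ℝ} (hr : 0 < r) {C : ℝ≥0}
    (hC : ∀ f : Lp ℝ 2 μ, MeanZero f → oscSq f ≠ ∞ → ‖f‖ ^ 2 ≤
      C * dirichlet (ContinuousLinearMap.adjoint (kernelOp T hT) ∘L kernelOp T hT) f
        + r * (oscSq f).toReal)
    {f : Lp ℝ 2 μ} (hf : MeanZero f) (hfin : oscSq f ≠ ∞) {n : ℕ} (hn : (C : ℝ) < n * r) :
    ‖(kernelOp T hT ^ n) f‖ ^ 2 ≤ 2 * r * (oscSq f).toReal := by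
  set φ := (oscSq f).toReal
  have hφ0 : 0 ≤ φ := ENNReal.toReal_nonneg
  have key : ∀ n : ℕ, ‖(kernelOp T hT ^ n) f‖ ^ 2 ≤ 2 * r * φ ∨
      n * (r * φ) ≤ C * (φ - ‖(kernelOp T hT ^ n) f‖ ^ 2) := by
    intro n
    induction n with
    | zero =>
      right
      have h := norm_sq_le_toReal_oscSq hf hfin
      have : 0 ≤ (C : ℝ) * (φ - ‖f‖ ^ 2) := mul_nonneg C.2 (by linarith)
      simpa using this
    | succ n ih =>
      have hmono := pow_le_pow_left₀ (norm_nonneg _) (norm_kernelOp_pow_succ_le hT n f) 2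
      by_cases hle : ‖(kernelOp T hT ^ n) f‖ ^ 2 ≤ 2 * r * φ
      · exact Or.inl (hmono.trans hle)
      · right
        have ih := ih.resolve_left hle
        have hosc := oscSq_kernelOp_pow_le hT n f
        have h1 := hC _ (hf.map_kernelOp_pow hT n) (ne_top_of_le_ne_top hfin hosc)
        rw [dirichlet_adjoint_comp_self, ← mul_apply_eq_comp, ← pow_succ'] at h1
        have h2 : r * (oscSq ((kernelOp T hT ^ n) f)).toReal ≤ r * φ :=
          mul_le_mul_of_nonneg_left (ENNReal.toReal_mono hfin hosc) hr.le
        rw [Nat.cast_succ]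
        linarith
  rcases key n with h | h
  · exact h
  · have h0 : ‖(kernelOp T hT ^ n) f‖ ^ 2 ≤ φ :=
      (pow_le_pow_left₀ (norm_nonneg _) (norm_kernelOp_pow_le hT n f) 2).trans
        (norm_sq_le_toReal_oscSq hf hfin)
    -- The final strict comparison needs `φ > 0`; for `φ = 0` the norm already vanishes.
    rcases hφ0.eq_or_lt with h1 | h1
    · rw [← h1] at h0 ⊢
      linarith
    · have h2 : (C : ℝ) * (φ - ‖(kernelOp T hT ^ n) f‖ ^ 2) ≤ C * φ :=
        mul_le_mul_of_nonneg_left (by linarith [sq_nonneg ‖(kernelOp T hT ^ n) f‖]) C.2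
      nlinarith [mul_lt_mul_of_pos_right hn h1]

theorem isConvergent_of_forall_exists (hT : T.Invariant μ)
    (h : ∀ r : ℝ, 0 < r → ∃ C : ℝ≥0, ∀ f : Lp ℝ 2 μ, MeanZero f → oscSq f ≠ ∞ → ‖f‖ ^ 2 ≤
      C * dirichlet (ContinuousLinearMap.adjoint (kernelOp T hT) ∘L kernelOp T hT) f
        + r * (oscSq f).toReal) :
    IsConvergent oscSq (kernelOp T hT) := by
  -- This is the best possible rate. Centred functions of zero oscillation contribute `0 / 0 = 0`.
  let G : ℕ → ℝ≥0∞ := fun n => ⨆ (f : Lp ℝ 2 μ) (_ : MeanZero f) (_ : oscSq f ≠ ∞),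
    ‖(kernelOp T hT ^ n) f‖ₑ ^ 2 / oscSq f
  have hG1 : ∀ n, G n ≤ 1 := fun n => by
    refine iSup_le fun f => iSup_le fun hf => iSup_le fun _ => ENNReal.div_le_of_le_mul ?_
    rw [one_mul]
    refine le_trans ?_ hf.enorm_sq_le_oscSq
    gcongr
    exact enorm_le_iff_norm_le.2 (norm_kernelOp_pow_le hT n f)
  have hGfin : ∀ n, G n ≠ ∞ := fun n => ne_top_of_le_ne_top ENNReal.one_ne_top (hG1 n)
  have hGanti : Antitone G := by
    refine antitone_nat_of_succ_le fun n => ?_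
    refine iSup_mono fun f => iSup_mono fun _ => iSup_mono fun _ => ?_
    gcongr
    exact enorm_le_iff_norm_le.2 (norm_kernelOp_pow_succ_le hT n f)
  have hGlim : Tendsto G atTop (𝓝 0) := by
    refine ENNReal.tendsto_atTop_zero.2 fun ε hε => ?_
    obtain ⟨r, hr, hrε⟩ : ∃ r : ℝ, 0 < r ∧ ENNReal.ofReal (2 * r) ≤ ε := by
      obtain ⟨q, hq0, hqε⟩ := ENNReal.lt_iff_exists_real_btwn.1 hε
      refine ⟨q / 2, ?_, ?_⟩
      · have := hqε.1
        rw [ENNReal.ofReal_pos] at this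
        linarith
      · rw [mul_div_cancel₀ _ (two_ne_zero)]
        exact hqε.2.le
    obtain ⟨C, hC⟩ := h r hr
    obtain ⟨N, hN⟩ := exists_nat_gt ((C : ℝ) / r)
    refine ⟨N, fun n hn => (iSup_le fun f => iSup_le fun hf => iSup_le fun hfin => ?_).trans hrε⟩
    refine ENNReal.div_le_of_le_mul ?_
    have hn' : (C : ℝ) < n * r := by
      rw [div_lt_iff₀ hr] at hN
      have : (N : ℝ) ≤ n := by exact_mod_cast hn
      nlinarith
    have h1 := ENNReal.ofReal_le_ofReal (norm_sq_kernelOp_pow_le hT hr hC hf hfin hn')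
    rwa [ENNReal.ofReal_mul (by positivity), ENNReal.ofReal_toReal hfin,
      ENNReal.ofReal_pow (norm_nonneg _), ofReal_norm] at h1
  refine ⟨fun n => (G n).toNNReal, fun m n hmn => ENNReal.toNNReal_mono (hGfin m) (hGanti hmn),
    (ENNReal.tendsto_toNNReal ENNReal.zero_ne_top).comp hGlim, fun f hf hpos hfin n _ => ?_⟩
  rw [ENNReal.coe_toNNReal (hGfin n), ← ENNReal.div_le_iff hpos.ne' hfin.ne]
  exact le_iSup_of_le f (le_iSup_of_le hf (le_iSup_of_le hfin.ne le_rfl))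

end Convergence

end MarkovWPI

/-! ### The theorem for irreducible kernels. -/

theorem mainTheorem6 {E : Type*} [MeasurableSpace E] [MeasurableEq E]
    (μ : Measure E) [IsProbabilityMeasure μ]
    (T : Kernel E E) [IsMarkovKernel T] (hT : T.Invariant μ)
    (hirr : Kernel.IsIrreducible μ T) :
    MarkovWPI.HasWPI MarkovWPI.oscSq (MarkovWPI.kernelOp T hT) ∧
    (0 < essInf (fun x => T x {x}) μ →
      MarkovWPI.HasWPI MarkovWPI.oscSq
        (ContinuousLinearMap.adjoint (MarkovWPI.kernelOp T hT) ∘L MarkovWPI.kernelOp T hT) ∧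
      MarkovWPI.IsConvergent MarkovWPI.oscSq (MarkovWPI.kernelOp T hT)) := by
  have hWPI : ∀ r : ℝ, 0 < r → ∃ C : ℝ≥0, ∀ f : Lp ℝ 2 μ, MarkovWPI.MeanZero f →
      MarkovWPI.oscSq f ≠ ∞ → ‖f‖ ^ 2 ≤
        C * MarkovWPI.dirichlet (MarkovWPI.kernelOp T hT) f + r * (MarkovWPI.oscSq f).toReal :=
    fun r hr => MarkovWPI.exists_norm_sq_le_of_isIrreducible hT hirr hr
  refine ⟨MarkovWPI.hasWPI_of_forall_exists MarkovWPI.isSieve_oscSq hWPI, fun hpos => ?_⟩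
  obtain ⟨δ, hδ0, hδ⟩ := ENNReal.lt_iff_exists_nnreal_btwn.1 hpos
  have hδ0 : 0 < δ := by exact_mod_cast hδ0
  have hae : ∀ᵐ x ∂μ, (δ : ℝ) ≤ (T x).real {x} := by
    filter_upwards [ae_lt_of_lt_essInf hδ] with x hx
    have := ENNReal.toReal_mono (measure_ne_top (T x) {x}) hx.le
    simpa [Measure.real] using this
  have hWPI' : ∀ r : ℝ, 0 < r → ∃ C : ℝ≥0, ∀ f : Lp ℝ 2 μ, MarkovWPI.MeanZero f →
      MarkovWPI.oscSq f ≠ ∞ → ‖f‖ ^ 2 ≤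
        C * MarkovWPI.dirichlet (ContinuousLinearMap.adjoint (MarkovWPI.kernelOp T hT) ∘L
          MarkovWPI.kernelOp T hT) f + r * (MarkovWPI.oscSq f).toReal := by
    intro r hr
    obtain ⟨C, hC⟩ := hWPI r hr
    -- The factor `2 * δ` comes from the bound of the form of `T*T` below by `2 * δ` times that of
    -- `T`.
    refine ⟨C / (2 * δ), fun f hf hfin => (hC f hf hfin).trans ?_⟩
    refine add_le_add_left ?_ _
    have h1 := MarkovWPI.two_mul_dirichlet_le_dirichlet_adjoint hT hae f
    have hδ' : (0 : ℝ) < δ := hδ0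
    push_cast
    calc (C : ℝ) * MarkovWPI.dirichlet (MarkovWPI.kernelOp T hT) f
        = C / (2 * δ) * (δ * (2 * MarkovWPI.dirichlet (MarkovWPI.kernelOp T hT) f)) := by
          field_simp
      _ ≤ _ := by gcongr
  exact ⟨MarkovWPI.hasWPI_of_forall_exists MarkovWPI.isSieve_oscSq hWPI',
    MarkovWPI.isConvergent_of_forall_exists hT hWPI'⟩
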